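/- Fix $n>2$ players and a constant $c\in(0,1]$. For a set $M$ of $m$ indivisible items, a valuation is a function $v:2^M\to\mathbb{R}_{\ge 0}$ that is monotone, has $v(\emptyset)=0$ and $v(M)>0$; it is submodular if $v(T\cup\{g\})-v(T)\le v(S\cup\{g\})-v(S)$ whenever $S\subseteq T\subseteq M$ and $g\in M$. An allocation is a partition $(A_1,\dots,A_n)$ of $M$ into $n$ disjoint, possibly empty bundles; it is $c$-EF for the valuations $(v_1,\dots,v_n)$ if $v_i(A_i)\ge c\cdot v_i(A_j)$ for all $i,j$. Each player $i$ knows only her own valuation $v_i$. In a protocol, the messages sent so far determine which player acts next, every message is seen by all players, each bit sent depends on the sender's valuation and on the messages so far, and the protocol ends when a player declares a result (the declaration itself is not counted as communication and may depend on her own valuation). A randomized protocol is public-coin: all players also see infinite streams of independent fair random bits, on which every step may depend. It must give a correct result with probability at least $2/3$ for every profile of submodular valuations, and its cost is the maximum number of bits sent, over all profiles of submodular valuations and all outcomes of the random bits. Let $R_{submod}(n,m,\mathrm{EF},c)$ be the minimum cost of a randomized protocol that finds a $c$-EF allocation or declares that none exists, and let $R^{dec}_{submod}(n,m,\mathrm{EF},c)$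 be the minimum cost of a randomized protocol that only determines whether a $c$-EF allocation exists. Theorem. For every fixed $n>2$ and every fixed $c\in(0,1]$, as $k\to\infty$, $$R^{dec}_{submod}(n,2k+n-2,\mathrm{EF},c)=\Omega\left(\binom{2k}{k}\right)\quad\text{and}\quad R_{submod}(n,2k+n-2,\mathrm{EF},c)=\Omega\left(\binom{2k}{k}\right).$$ -/

import Mathlib

open Filter Asymptotics MeasureTheory

namespace FairDivision

/-- A valuation on the item set `Fin m`: a normalized, monotone function from bundles to the
nonnegative reals, with positive value for the set of all items. -/
structure Valuation (m : ℕ) where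
  val : Finset (Fin m) → ℝ
  nonneg : ∀ S, 0 ≤ val S
  empty : val ∅ = 0
  mono : ∀ S T, S ⊆ T → val S ≤ val T
  pos : 0 < val Finset.univ

/-- Diminishing marginal values. -/
def Valuation.IsSubmodular {m : ℕ} (v : Valuation m) : Prop :=
  ∀ (S T : Finset (Fin m)) (g : Fin m), S ⊆ T →
    v.val (insert g T) - v.val T ≤ v.val (insert g S) - v.val S

/-- The submodular valuations on `m` items: the private input of one player. -/
def SubmodularValuation (m : ℕ) : Type := {v : Valuation m // v.IsSubmodular}

/-- A partition of the `m` items into `n` (possibly empty) bundles, given by the owner of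
each item. -/
abbrev Allocation (n m : ℕ) : Type := Fin m → Fin n

/-- The bundle that player `i` receives. -/
def Allocation.bundle {n m : ℕ} (A : Allocation n m) (i : Fin n) : Finset (Fin m) :=
  Finset.univ.filter fun g => A g = i

/-- The allocation `A` is `c`-EF for the valuations `v`. -/
def IsEF {n m : ℕ} (c : ℝ) (v : Fin n → SubmodularValuation m) (A : Allocation n m) : Prop :=
  ∀ i j : Fin n, c * (v i).1.val (A.bundle j) ≤ (v i).1.val (A.bundle i)

/-- A deterministic `n`-party protocol in which every message is seen by all players; `V` is the
type of the private input of one player, `O` the type of results. The messages sent so far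
determine who acts next. That player either sends one bit, which depends on her own input, or
ends the protocol by declaring a result, which may also depend on her own input. -/
inductive Protocol (n : ℕ) (V O : Type) : Type
  | declare (i : Fin n) (result : V → O) : Protocol n V O
  | send (i : Fin n) (bit : V → Bool) (next : Bool → Protocol n V O) : Protocol n V O

/-- The declared result on the inputs `v`. -/
def Protocol.output {n : ℕ} {V O : Type} : Protocol n V O → (Fin n → V) → O
  | .declare i result, v => result (v i)
  | .send i bit next, v => (next (bit (v i))).output v

/-- The number of bits sent on the inputs `v`. -/
def Protocol.bits {n : ℕ} {V O : Type} : Protocol n V O → (Fin n → V) → ℕ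
  | .declare _ _, _ => 0
  | .send i bit next, v => (next (bit (v i))).bits v + 1

/-- An infinite stream of bits for each of the `n` players. -/
abbrev Coins (n : ℕ) : Type := Fin n × ℕ → Bool

/-- All bits of all streams are independent and fair. -/
noncomputable def coinMeasure (n : ℕ) : Measure (Coins n) :=
  Measure.infinitePi fun _ => (PMF.uniformOfFintype Bool).toMeasure

/-- A public-coin randomized protocol: all players see all random bits, and so every outcome of
the random bits gives a deterministic protocol. The result on any fixed inputs is a random
variable. -/
structure RandomizedProtocol (n : ℕ) (V O : Type) where
  det : Coins n → Protocol n V O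
  measurable_output : ∀ (v : Fin n → V) (o : O), MeasurableSet {ω | (det ω).output v = o}

/-- On all inputs, the result meets the specification with probability at least `2/3`. -/
def RandomizedProtocol.IsCorrect {n : ℕ} {V O : Type} (Γ : RandomizedProtocol n V O)
    (spec : (Fin n → V) → O → Prop) : Prop :=
  ∀ v : Fin n → V, 2 / 3 ≤ (coinMeasure n).real {ω | spec v ((Γ.det ω).output v)}

/-- At most `b` bits are sent, for all inputs and all outcomes of the random bits. -/
def RandomizedProtocol.CostAtMost {n : ℕ} {V O : Type} (Γ : RandomizedProtocol n V O)
    (b : ℕ) : Prop :=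
  ∀ (ω : Coins n) (v : Fin n → V), (Γ.det ω).bits v ≤ b

/-- The randomized communication complexity of a problem: the minimum worst-case cost of a
correct public-coin protocol. -/
noncomputable def randomizedComplexity {n : ℕ} {V O : Type} (spec : (Fin n → V) → O → Prop) : ℕ :=
  sInf {b | ∃ Γ : RandomizedProtocol n V O, Γ.IsCorrect spec ∧ Γ.CostAtMost b}

/-- Determine whether a `c`-EF allocation exists. -/
def decideEF (n m : ℕ) (c : ℝ) (v : Fin n → SubmodularValuation m) (o : Bool) : Prop :=
  o = true ↔ ∃ A : Allocation n m, IsEF c v A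

/-- Find a `c`-EF allocation, or declare (by `none`) that there is none. -/
def findEF (n m : ℕ) (c : ℝ) (v : Fin n → SubmodularValuation m) :
    Option (Allocation n m) → Prop
  | some A => IsEF c v A
  | none => ¬ ∃ A : Allocation n m, IsEF c v A

/-- The complexity of deciding whether a `c`-EF allocation exists, for submodular valuations. -/
noncomputable def RsubmodDecideEF (n m : ℕ) (c : ℝ) : ℕ :=
  randomizedComplexity (decideEF n m c)

/-- The complexity `R_submod(n, m, EF, c)` of the fair division problem. -/
noncomputable def RsubmodEF (n m : ℕ) (c : ℝ) : ℕ :=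
  randomizedComplexity (findEF n m c)

end FairDivision

/-! The proof embeds set disjointness on the `N = (2k choose k)` half-size subsets of `2k` main
items into the existence question. Each player beyond the first two wants one private item and must
receive it. The first two value such an item at `k / c`, so each needs a bundle worth at least `k`.
Their valuations count main items up to `k`, except that a bundle of size `k` may be worth `k -
1/2`. This keeps submodularity, whichever bundles are marked down. Two disjoint bundles worth `k`
among `2k` items are complementary halves, both unmarked. Thus a `c`-EF allocation exists exactly
when two arbitrary families of half sets intersect (`exists_isEF_profile_iff`).

Disjointness needs linearly many bits by a corruption argument (`corruption_bound`): up to an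
exponentially small error, a product `f x * g y` has intersecting mass at least `N / 16` times its
disjoint mass. The reason is that a subcube on which many coordinates are biased under `f` carries
little mass, while at an unbiased coordinate setting the bit to one loses only a constant factor. A
protocol with `b` bits is a mixture of at most `2 ^ b` rectangles
(`RandomizedProtocol.rectBounded`), and the fifth power of its probability of answering "disjoint"
brings the error below the constant that corruption tolerates (`disjointness_bound`).

A search protocol also decides existence, so one bound serves both complexities. As the infimum of
an empty set of naturals is zero, some correct protocol of finite cost must also be exhibited
(`exists_findEF_protocol`). -/

namespace FairDivision

/-! ### Corruption bound for set disjointness on the Boolean cube. -/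

section Cube

variable {ι : Type} [DecidableEq ι]

/-- The coordinatewise conjunction. -/
def mask (d x : ι → Bool) : ι → Bool := fun i => d i && x i

/-- The coordinatewise negation. -/
def compl (d : ι → Bool) : ι → Bool := fun i => !d i

/-- The point `d` with coordinate `i` flipped. -/
def flip (i : ι) (d : ι → Bool) : ι → Bool := Function.update d i (!d i)

lemma flip_flip (i : ι) (d : ι → Bool) : flip i (flip i d) = d := by
  ext j; by_cases h : j = i
  · subst h; simp [flip]
  · simp [flip, h]

lemma compl_flip (i : ι) (d : ι → Bool) : compl (flip i d) = flip i (compl d) := by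
  ext j; by_cases h : j = i
  · subst h; simp [flip, compl]
  · simp [flip, compl, h]

lemma update_mask_flip (i : ι) (β : Bool) (d x : ι → Bool) :
    Function.update (mask (flip i d) x) i β = Function.update (mask d x) i β := by
  ext j; by_cases h : j = i
  · subst h; simp
  · simp [mask, flip, h]

variable [Fintype ι]

/-- The base of the exponential bound on the size of a set with biased coordinates. -/
noncomputable def biasRate : ℝ := (Real.exp (1 / 4) + Real.exp (-(3 / 4))) / 2

lemma biasRate_pos : 0 < biasRate := by
  unfold biasRate; positivity

/-- With `z = exp (1 / 4)` the base is `(z + z⁻³) / 2`, where `z < 1.29` and `z ^ 3 > 2`. -/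
lemma biasRate_lt_one : biasRate < 1 := by
  unfold biasRate
  set z := Real.exp (1 / 4) with hz
  have hz0 : 0 < z := Real.exp_pos _
  have h4 : z ^ 4 = Real.exp 1 := by
    rw [hz, ← Real.exp_nat_mul]; norm_num
  have h3 : Real.exp (-(3 / 4)) = (z ^ 3)⁻¹ := by
    rw [hz, ← Real.exp_nat_mul, ← Real.exp_neg]; norm_num
  have hlo := Real.exp_one_gt_d9
  have hhi := Real.exp_one_lt_d9
  rw [← h4] at hlo hhi
  have hz1 : 1.28 < z := by
    by_contra hcon
    have : z ^ 4 ≤ 1.28 ^ 4 := pow_le_pow_left₀ hz0.le (not_lt.1 hcon) 4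
    norm_num at this hlo
    linarith
  have hz2 : z < 1.29 := by
    by_contra hcon
    have : (1.29 : ℝ) ^ 4 ≤ z ^ 4 := pow_le_pow_left₀ (by norm_num) (not_lt.1 hcon) 4
    norm_num at this hhi
    linarith
  have hz3 : 2 < z ^ 3 := by
    have : (1.28 : ℝ) ^ 3 ≤ z ^ 3 := pow_le_pow_left₀ (by norm_num) hz1.le 3
    norm_num at this
    linarith
  have : (z ^ 3)⁻¹ < 2⁻¹ := by gcongr
  rw [h3]
  norm_num at *
  linarith

/-- A weight on the cube that is biased on many coordinates has exponentially small mass. -/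
lemma sum_le_of_biased (φ : (ι → Bool) → ℝ) (h0 : ∀ x, 0 ≤ φ x) (h1 : ∀ x, φ x ≤ 1)
    (T : Finset ι) (s : ι → Bool)
    (hT : ∀ i ∈ T, 3 / 4 * ∑ x, φ x ≤ ∑ x, if x i = s i then φ x else 0) :
    ∑ x, φ x ≤ 2 ^ Fintype.card ι * biasRate ^ T.card := by
  -- A Chernoff argument: the added sum has nonnegative mean under `φ`. Then `1 + t ≤ exp t` and `φ
  -- ≤ 1` leave a sum over the whole cube that factors over coordinates.
  have key : ∑ x, φ x ≤ ∑ x, φ x * (1 + ∑ i ∈ T, ((if x i = s i then 1 else 0) - 3 / 4)) := by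
    have h : ∑ x, φ x * ∑ i ∈ T, ((if x i = s i then (1 : ℝ) else 0) - 3 / 4)
        = ∑ i ∈ T, ((∑ x, if x i = s i then φ x else 0) - 3 / 4 * ∑ x, φ x) := by
      simp_rw [Finset.mul_sum]
      rw [Finset.sum_comm]
      refine Finset.sum_congr rfl fun i _ => ?_
      rw [← Finset.sum_sub_distrib]
      refine Finset.sum_congr rfl fun x _ => ?_
      split_ifs <;> ring
    simp_rw [mul_add, mul_one]
    rw [Finset.sum_add_distrib, h]
    have := Finset.sum_nonneg fun i hi => sub_nonneg.2 (hT i hi)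
    linarith
  refine key.trans ?_
  have step : ∀ x : ι → Bool,
      φ x * (1 + ∑ i ∈ T, ((if x i = s i then (1 : ℝ) else 0) - 3 / 4))
      ≤ ∏ i, if i ∈ T then (if x i = s i then Real.exp (1 / 4) else Real.exp (-(3 / 4)))
        else 1 := by
    intro x
    have hexp : Real.exp (∑ i ∈ T, ((if x i = s i then (1 : ℝ) else 0) - 3 / 4))
        = ∏ i, if i ∈ T then (if x i = s i then Real.exp (1 / 4) else Real.exp (-(3 / 4)))
          else 1 := by
      rw [Real.exp_sum, Finset.prod_ite_mem, Finset.univ_inter]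
      refine Finset.prod_congr rfl fun i _ => ?_
      split_ifs <;> norm_num
    rw [← hexp]
    have hle := Real.add_one_le_exp (∑ i ∈ T, ((if x i = s i then (1 : ℝ) else 0) - 3 / 4))
    calc _ ≤ φ x * Real.exp _ := mul_le_mul_of_nonneg_left (by linarith) (h0 x)
      _ ≤ 1 * Real.exp _ := mul_le_mul_of_nonneg_right (h1 x) (Real.exp_pos _).le
      _ = _ := one_mul _
  refine (Finset.sum_le_sum fun x _ => step x).trans (le_of_eq ?_)
  rw [← Fintype.prod_sum (fun (i : ι) (β : Bool) =>
    if i ∈ T then (if β = s i then Real.exp (1 / 4) else Real.exp (-(3 / 4))) else 1)]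
  have hfac : ∀ i, (∑ β : Bool,
      if i ∈ T then (if β = s i then Real.exp (1 / 4) else Real.exp (-(3 / 4))) else 1)
      = 2 * if i ∈ T then biasRate else 1 := by
    intro i
    unfold biasRate
    by_cases hi : i ∈ T
    · cases hs : s i <;> simp [hi] <;> ring
    · simp [hi]
  simp_rw [hfac]
  rw [Finset.prod_mul_distrib, Finset.prod_ite_mem]
  simp

/-- The mass of `f` on the subcube of the points supported on `d`. -/
def subcubeMass (f : (ι → Bool) → ℝ) (d : ι → Bool) : ℝ := ∑ x, f (mask d x)

/-- The mass of `f` on the subcube of `d` with coordinate `i` fixed to `β`. -/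
def sliceMass (f : (ι → Bool) → ℝ) (i : ι) (β : Bool) (d : ι → Bool) : ℝ :=
  ∑ x, f (Function.update (mask d x) i β)

/-- Coordinate `i` is free in the subcube of `d`, but far from uniform under `f`. -/
def IsBiased (f : (ι → Bool) → ℝ) (i : ι) (d : ι → Bool) : Prop :=
  d i = true ∧ ∃ β, 2 * sliceMass f i β d < subcubeMass f d

lemma sum_flip (i : ι) (F : (ι → Bool) → ℝ) : ∑ x, F (flip i x) = ∑ x, F x :=
  Equiv.sum_comp (Function.Involutive.toPerm (flip i) (flip_flip i)) F

lemma sliceMass_flip (f : (ι → Bool) → ℝ) (i : ι) (β : Bool) (d : ι → Bool) :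
    sliceMass f i β (flip i d) = sliceMass f i β d := by
  simp only [sliceMass, update_mask_flip]

lemma subcubeMass_of_false (f : (ι → Bool) → ℝ) {i : ι} {d : ι → Bool} (h : d i = false) :
    subcubeMass f d = sliceMass f i false d := by
  unfold subcubeMass sliceMass
  refine Finset.sum_congr rfl fun x _ => congrArg f ?_
  rw [eq_comm, Function.update_eq_self_iff]
  simp [mask, h]

/-- Overwriting the free bit `x i` counts every point of the slice twice. Hence a slice mass equals
the subcube mass for a uniform coordinate, and bias means that one value has less than a quarter of
the mass. -/
lemma sliceMass_of_true (f : (ι → Bool) → ℝ) {i : ι} {d : ι → Bool} (h : d i = true) (β : Bool) :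
    sliceMass f i β d = 2 * ∑ x, if x i = β then f (mask d x) else 0 := by
  have e : ∀ x : ι → Bool, f (Function.update (mask d x) i β)
      = (if x i = β then f (mask d x) else 0)
        + if flip i x i = β then f (mask d (flip i x)) else 0 := by
    intro x
    by_cases hx : x i = β
    · have h2 : flip i x i ≠ β := by subst hx; simp [flip]
      rw [if_pos hx, if_neg h2, add_zero]
      congr 1
      rw [Function.update_eq_self_iff]
      simp [mask, h, hx]
    · have h2 : flip i x i = β := by
        revert hx; simp only [flip, Function.update_self]; cases x i <;> cases β <;> simp
      rw [if_neg hx, if_pos h2, zero_add]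
      congr 1
      ext j; by_cases hj : j = i
      · subst hj; simp [mask, h, h2]
      · simp [mask, flip, hj]
  unfold sliceMass
  simp_rw [e]
  rw [Finset.sum_add_distrib, sum_flip i (fun x => if x i = β then f (mask d x) else 0)]
  ring

lemma subcubeMass_of_true (f : (ι → Bool) → ℝ) {i : ι} {d : ι → Bool} (h : d i = true) :
    2 * subcubeMass f d = sliceMass f i true d + sliceMass f i false d := by
  rw [sliceMass_of_true f h, sliceMass_of_true f h, ← mul_add, ← Finset.sum_add_distrib]
  unfold subcubeMass
  congr 1
  refine Finset.sum_congr rfl fun x _ => ?_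
  cases x i <;> simp

lemma subcubeMass_nonneg {f : (ι → Bool) → ℝ} (h0 : ∀ x, 0 ≤ f x) (d : ι → Bool) :
    0 ≤ subcubeMass f d := Finset.sum_nonneg fun _ _ => h0 _

lemma sliceMass_nonneg {f : (ι → Bool) → ℝ} (h0 : ∀ x, 0 ≤ f x) (i : ι) (β : Bool)
    (d : ι → Bool) : 0 ≤ sliceMass f i β d := Finset.sum_nonneg fun _ _ => h0 _

lemma subcubeMass_le {f : (ι → Bool) → ℝ} (h1 : ∀ x, f x ≤ 1) (d : ι → Bool) :
    subcubeMass f d ≤ 2 ^ Fintype.card ι := by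
  refine (Finset.sum_le_sum fun x _ => h1 (mask d x)).trans ?_
  simp

open Classical in
/-- The number of biased coordinates. -/
noncomputable def biasCount (f : (ι → Bool) → ℝ) (d : ι → Bool) : ℕ :=
  (Finset.univ.filter fun i => IsBiased f i d).card

lemma subcubeMass_le_of_biasCount {f : (ι → Bool) → ℝ} (h0 : ∀ x, 0 ≤ f x) (h1 : ∀ x, f x ≤ 1)
    (d : ι → Bool) : subcubeMass f d ≤ 2 ^ Fintype.card ι * biasRate ^ biasCount f d := by
  classical
  have hs : ∀ i, ∃ s, IsBiased f i d →
      3 / 4 * ∑ x, f (mask d x) ≤ ∑ x, if x i = s then f (mask d x) else 0 := by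
    intro i
    by_cases hi : IsBiased f i d
    · obtain ⟨hd, β, hβ⟩ := hi
      refine ⟨!β, fun _ => ?_⟩
      have hsum := subcubeMass_of_true f hd
      have ht := sliceMass_of_true f hd (!β)
      have hm : subcubeMass f d = ∑ x, f (mask d x) := rfl
      cases β <;> simp only [Bool.not_true, Bool.not_false] at ht ⊢ <;> linarith
    · exact ⟨true, fun h => absurd h hi⟩
  choose s hs using hs
  exact sum_le_of_biased (fun x => f (mask d x)) (fun _ => h0 _) (fun _ => h1 _) _ s
    fun i hi => hs i (Finset.mem_filter.1 hi).2

/-- Either at most a twentieth of the coordinates are biased, or the mass of `f` is exponentially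
small and the trivial bounds on the other factors suffice. -/
lemma subcubeMass_mul_biasCount_le {f g : (ι → Bool) → ℝ} (f0 : ∀ x, 0 ≤ f x)
    (f1 : ∀ x, f x ≤ 1) (g0 : ∀ x, 0 ≤ g x) (g1 : ∀ x, g x ≤ 1) (d e : ι → Bool) :
    subcubeMass f d * subcubeMass g e * biasCount f d
      ≤ subcubeMass f d * subcubeMass g e * (Fintype.card ι / 20)
        + Fintype.card ι * 4 ^ Fintype.card ι * biasRate ^ ((Fintype.card ι : ℝ) / 20) := by
  set N := Fintype.card ι
  have hf := subcubeMass_nonneg f0 d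
  have hg := subcubeMass_nonneg g0 e
  have hρ := Real.rpow_nonneg biasRate_pos.le ((N : ℝ) / 20)
  by_cases h : (biasCount f d : ℝ) ≤ N / 20
  · have := mul_le_mul_of_nonneg_left h (mul_nonneg hf hg)
    have : 0 ≤ (N : ℝ) * 4 ^ N * biasRate ^ ((N : ℝ) / 20) := by positivity
    linarith
  · have hle : (biasCount f d : ℝ) ≤ N := by
      exact_mod_cast (Finset.card_le_univ _)
    have h2 : biasRate ^ biasCount f d ≤ biasRate ^ ((N : ℝ) / 20) := by
      rw [← Real.rpow_natCast]
      exact Real.rpow_le_rpow_of_exponent_ge biasRate_pos biasRate_lt_one.le (not_le.1 h).le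
    have h3 : subcubeMass f d ≤ 2 ^ N * biasRate ^ ((N : ℝ) / 20) :=
      (subcubeMass_le_of_biasCount f0 f1 d).trans (by gcongr)
    have h4 := subcubeMass_le g1 e
    have : subcubeMass f d * subcubeMass g e * biasCount f d
        ≤ (2 ^ N * biasRate ^ ((N : ℝ) / 20)) * 2 ^ N * N := by
      gcongr
    have e4 : (4 : ℝ) ^ N = 2 ^ N * 2 ^ N := by rw [← mul_pow]; norm_num
    have h5 : 0 ≤ subcubeMass f d * subcubeMass g e * ((N : ℝ) / 20) := by positivity
    rw [e4]
    linarith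

/-- If neither side is biased, `a * b ≤ 4 * a1 * b1`, and each term on the left is at most `2 * a *
b`; this gives 16. If just one side is biased, the other term is at most four times the biased one,
so a penalty of `5 = 1 + 4` makes the left side nonpositive. -/
lemma slice_mul_slice_ge (a a0 a1 b b0 b1 p q : ℝ) (ha0 : 0 ≤ a0) (ha1 : 0 ≤ a1) (hb0 : 0 ≤ b0)
    (hb1 : 0 ≤ b1) (ha : 2 * a = a1 + a0) (hb : 2 * b = b1 + b0) (hp0 : 0 ≤ p) (hq0 : 0 ≤ q)
    (hp : p = 1 ∨ (a ≤ 2 * a0 ∧ a ≤ 2 * a1)) (hq : q = 1 ∨ (b ≤ 2 * b0 ∧ b ≤ 2 * b1)) :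
    a * b0 * (1 - 5 * p) + a0 * b * (1 - 5 * q) ≤ 16 * (a1 * b1) := by
  have hab : 0 ≤ a1 * b1 := mul_nonneg ha1 hb1
  have han : 0 ≤ a := by linarith
  have hbn : 0 ≤ b := by linarith
  have hu : 0 ≤ a * b0 := mul_nonneg han hb0
  have hv : 0 ≤ a0 * b := mul_nonneg ha0 hbn
  have hup := mul_nonneg hu hp0
  have hvq := mul_nonneg hv hq0
  rcases hp with rfl | ⟨hp, hp'⟩ <;> rcases hq with rfl | ⟨hq, hq'⟩
  · linarith
  · have : a0 * b ≤ (2 * a) * (2 * b0) := by gcongr; linarith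
    linarith
  · have : a * b0 ≤ (2 * a0) * (2 * b) := by gcongr; linarith
    linarith
  · have h1 : a * b ≤ (2 * a1) * (2 * b1) := by gcongr
    have h2 : a * b0 ≤ a * (2 * b) := by gcongr; linarith
    have h3 : a0 * b ≤ (2 * a) * b := by gcongr; linarith
    linarith

open Classical in
/-- One if the coordinate `i` is biased, and zero otherwise. -/
noncomputable def biasInd (f : (ι → Bool) → ℝ) (i : ι) (d : ι → Bool) : ℝ :=
  if IsBiased f i d then 1 else 0

lemma biasInd_nonneg (f : (ι → Bool) → ℝ) (i : ι) (d : ι → Bool) : 0 ≤ biasInd f i d := by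
  unfold biasInd; split_ifs <;> norm_num

lemma biasInd_of_false (f : (ι → Bool) → ℝ) {i : ι} {d : ι → Bool} (h : d i = false) :
    biasInd f i d = 0 := by
  unfold biasInd; rw [if_neg]; rintro ⟨h', _⟩; simp [h] at h'

lemma sum_biasInd (f : (ι → Bool) → ℝ) (d : ι → Bool) :
    ∑ i, biasInd f i d = biasCount f d := by
  simp [biasInd, biasCount]

lemma biasInd_eq_one_or (f : (ι → Bool) → ℝ) {i : ι} {d : ι → Bool} (h : d i = true) :
    biasInd f i d = 1 ∨ (subcubeMass f d ≤ 2 * sliceMass f i false d ∧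
      subcubeMass f d ≤ 2 * sliceMass f i true d) := by
  by_cases hb : IsBiased f i d
  · left; simp [biasInd, hb]
  · right
    simp only [IsBiased, h, true_and, not_exists, not_lt] at hb
    exact ⟨hb _, hb _⟩

/-- The contribution of `d` to the mass of `f ⊗ g`, discounted if `i` is biased. -/
noncomputable def discounted (f g : (ι → Bool) → ℝ) (i : ι) (d : ι → Bool) : ℝ :=
  subcubeMass f d * subcubeMass g (compl d) *
    (1 - 5 * (biasInd f i d + biasInd g i (compl d)))

/-- Exactly one side is free at `i`, and flipping `d` at `i` swaps which one. Slices ignore `d i`,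
so both terms compare with the same intersecting mass. -/
lemma discounted_add_flip_le {f g : (ι → Bool) → ℝ} (f0 : ∀ x, 0 ≤ f x) (g0 : ∀ x, 0 ≤ g x)
    (i : ι) (d : ι → Bool) :
    discounted f g i d + discounted f g i (flip i d)
      ≤ 16 * (sliceMass f i true d * sliceMass g i true (compl d)) := by
  have main : ∀ d : ι → Bool, d i = true → discounted f g i d + discounted f g i (flip i d)
      ≤ 16 * (sliceMass f i true d * sliceMass g i true (compl d)) := by
    intro d hd
    have hd' : flip i d i = false := by simp [flip, hd]
    have hc : compl d i = false := by simp [compl, hd]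
    have hc' : flip i (compl d) i = true := by simp [flip, compl, hd]
    unfold discounted
    rw [compl_flip, biasInd_of_false f hd', biasInd_of_false g hc, add_zero, zero_add,
      subcubeMass_of_false g hc, subcubeMass_of_false f hd', sliceMass_flip]
    have hb := subcubeMass_of_true g hc'
    have hq := biasInd_eq_one_or g hc'
    rw [sliceMass_flip, sliceMass_flip] at hb hq
    exact slice_mul_slice_ge _ _ _ _ _ _ _ _ (sliceMass_nonneg f0 _ _ _)
      (sliceMass_nonneg f0 _ _ _) (sliceMass_nonneg g0 _ _ _) (sliceMass_nonneg g0 _ _ _)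
      (subcubeMass_of_true f hd) hb (biasInd_nonneg _ _ _) (biasInd_nonneg _ _ _)
      (biasInd_eq_one_or f hd) hq
  cases hd : d i
  · have h := main (flip i d) (by simp [flip, hd])
    rw [flip_flip, compl_flip, sliceMass_flip, sliceMass_flip] at h
    linarith
  · exact main d hd

/-- The unnormalized distribution on disjoint pairs, as a linear functional: a uniformly random
side of each coordinate is zero, and the other side is a uniformly random bit. -/
def disjointMass : ((ι → Bool) → (ι → Bool) → ℝ) →ₗ[ℝ] ℝ where
  toFun P := ∑ d, ∑ x, ∑ y, P (mask d x) (mask (compl d) y)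
  map_add' P Q := by simp [Finset.sum_add_distrib]
  map_smul' a P := by simp [Finset.mul_sum]

/-- The unnormalized distribution on intersecting pairs: a pair as in `disjointMass`, changed to
one on both sides of a uniformly random coordinate. -/
def intersectingMass : ((ι → Bool) → (ι → Bool) → ℝ) →ₗ[ℝ] ℝ where
  toFun P := ∑ i, ∑ d, ∑ x, ∑ y,
    P (Function.update (mask d x) i true) (Function.update (mask (compl d) y) i true)
  map_add' P Q := by simp [Finset.sum_add_distrib]
  map_smul' a P := by simp [Finset.mul_sum]

lemma disjointMass_rect (f g : (ι → Bool) → ℝ) :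
    disjointMass (fun x y => f x * g y) = ∑ d, subcubeMass f d * subcubeMass g (compl d) := by
  simp only [disjointMass, LinearMap.coe_mk, AddHom.coe_mk, subcubeMass, Finset.sum_mul_sum]

lemma intersectingMass_rect (f g : (ι → Bool) → ℝ) :
    intersectingMass (fun x y => f x * g y)
      = ∑ i, ∑ d, sliceMass f i true d * sliceMass g i true (compl d) := by
  simp only [intersectingMass, LinearMap.coe_mk, AddHom.coe_mk, sliceMass, Finset.sum_mul_sum]

/-- The corruption bound for set disjointness. -/
theorem corruption_bound {f g : (ι → Bool) → ℝ} (f0 : ∀ x, 0 ≤ f x)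
    (f1 : ∀ x, f x ≤ 1) (g0 : ∀ x, 0 ≤ g x) (g1 : ∀ x, g x ≤ 1) :
    Fintype.card ι / 16 * disjointMass (fun x y => f x * g y)
        - intersectingMass (fun x y => f x * g y)
      ≤ 5 / 4 * (Fintype.card ι * 8 ^ Fintype.card ι *
          biasRate ^ ((Fintype.card ι : ℝ) / 20)) := by
  rw [disjointMass_rect, intersectingMass_rect]
  set N := Fintype.card ι with hN
  set E := biasRate ^ ((N : ℝ) / 20)
  -- Summing over all `d` counts each discounted term twice, so 16 becomes 8.
  have h1 : ∑ i, ∑ d, discounted f g i d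
      ≤ 8 * ∑ i, ∑ d, sliceMass f i true d * sliceMass g i true (compl d) := by
    rw [Finset.mul_sum]
    refine Finset.sum_le_sum fun i _ => ?_
    have h := Finset.sum_le_sum fun d (_ : d ∈ Finset.univ) => discounted_add_flip_le f0 g0 i d
    rw [Finset.sum_add_distrib, sum_flip i (discounted f g i), ← Finset.mul_sum] at h
    linarith
  -- Up to the error, each side has at most `N / 20` biased coordinates, and `N - 5 * (N / 20 + N /
  -- 20) = N / 2`.
  have h2 : ∑ d, (N / 2 * (subcubeMass f d * subcubeMass g (compl d)) - 10 * (N * 4 ^ N * E))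
      ≤ ∑ i, ∑ d, discounted f g i d := by
    rw [Finset.sum_comm]
    refine Finset.sum_le_sum fun d _ => ?_
    have e : ∑ i, discounted f g i d = subcubeMass f d * subcubeMass g (compl d) *
        (N - 5 * (biasCount f d + biasCount g (compl d))) := by
      unfold discounted
      rw [← Finset.mul_sum, Finset.sum_sub_distrib, ← Finset.mul_sum, Finset.sum_add_distrib,
        sum_biasInd, sum_biasInd]
      simp [hN]
    rw [e]
    have ha := subcubeMass_mul_biasCount_le f0 f1 g0 g1 d (compl d)
    have hb := subcubeMass_mul_biasCount_le g0 g1 f0 f1 (compl d) d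
    rw [← hN] at ha hb
    rw [mul_comm (subcubeMass g (compl d))] at hb
    linarith
  rw [Finset.sum_sub_distrib, ← Finset.mul_sum] at h2
  have h3 : ∑ _d : ι → Bool, 10 * ((N : ℝ) * 4 ^ N * E) = 10 * (N * 8 ^ N * E) := by
    have e8 : (8 : ℝ) ^ N = 2 ^ N * 4 ^ N := by rw [← mul_pow]; norm_num
    rw [e8]
    simp [← hN]
    ring
  rw [h3] at h2
  linarith

end Cube

instance (n : ℕ) : IsProbabilityMeasure (coinMeasure n) := by
  unfold coinMeasure; infer_instance

/-! ### Protocols as mixtures of rectangles. -/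

section Rectangles

variable {X Y : Type}

open Classical in
/-- The indicator of a proposition. -/
noncomputable def ind (p : Prop) : ℝ := if p then 1 else 0

lemma ind_of_false {p : Prop} (h : ¬ p) : ind p = 0 := if_neg h

lemma ind_mem_Icc (p : Prop) : ind p ∈ Set.Icc 0 1 := by
  unfold ind; split_ifs <;> simp

/-- `P` is dominated by `T` rectangles: a linear functional that is at most `ε` on all products
of functions with values in `[0, 1]` is at most `T * ε` on `P`. -/
def RectBounded (T : ℝ) (P : X → Y → ℝ) : Prop :=
  ∀ (L : (X → Y → ℝ) →ₗ[ℝ] ℝ) (ε : ℝ),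
    (∀ (f : X → ℝ) (g : Y → ℝ), (∀ x, f x ∈ Set.Icc 0 1) → (∀ y, g y ∈ Set.Icc 0 1) →
      L (fun x y => f x * g y) ≤ ε) → L P ≤ T * ε

lemma RectBounded.mono {T T' : ℝ} {P : X → Y → ℝ} (h : RectBounded T P) (hT : T ≤ T') :
    RectBounded T' P := by
  intro L ε hL
  -- The zero rectangle is among the test functions.
  have hε : 0 ≤ ε := by
    have := hL 0 0 (by simp) (by simp)
    have e : (fun (x : X) (y : Y) => (0 : X → ℝ) x * (0 : Y → ℝ) y) = 0 := by ext; simp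
    rwa [e, map_zero] at this
  exact (h L ε hL).trans (mul_le_mul_of_nonneg_right hT hε)

lemma rectBounded_rect {f : X → ℝ} {g : Y → ℝ} (hf : ∀ x, f x ∈ Set.Icc 0 1)
    (hg : ∀ y, g y ∈ Set.Icc 0 1) : RectBounded 1 (fun x y => f x * g y) := by
  intro L ε hL
  rw [one_mul]; exact hL f g hf hg

lemma rectBounded_zero : RectBounded 0 (0 : X → Y → ℝ) := by
  intro L ε _; simp

lemma RectBounded.add {T T' : ℝ} {P Q : X → Y → ℝ} (hP : RectBounded T P)
    (hQ : RectBounded T' Q) : RectBounded (T + T') (P + Q) := by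
  intro L ε hL
  rw [map_add, add_mul]; exact add_le_add (hP L ε hL) (hQ L ε hL)

/-- A product of rectangles is a rectangle, so the two bounds can be applied in turn to the
functional precomposed with multiplication. This makes error reduction possible without building a
repeated protocol. -/
lemma RectBounded.mul {T T' : ℝ} {P Q : X → Y → ℝ} (hP : RectBounded T P)
    (hQ : RectBounded T' Q) : RectBounded (T * T') (P * Q) := by
  intro L ε hL
  have h := hP (L ∘ₗ LinearMap.mulRight ℝ Q) (T' * ε) ?_
  · rw [mul_assoc]; simpa using h
  intro f g hf hg
  have h2 := hQ (L ∘ₗ LinearMap.mulLeft ℝ (fun x y => f x * g y)) ε ?_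
  · simpa using h2
  intro f' g' hf' hg'
  have := hL (fun x => f x * f' x) (fun y => g y * g' y)
    (fun x => ⟨mul_nonneg (hf x).1 (hf' x).1, mul_le_one₀ (hf x).2 (hf' x).1 (hf' x).2⟩)
    (fun y => ⟨mul_nonneg (hg y).1 (hg' y).1, mul_le_one₀ (hg y).2 (hg' y).1 (hg' y).2⟩)
  simp only [LinearMap.comp_apply, LinearMap.mulLeft_apply]
  convert this using 2
  ext x y
  simp only [Pi.mul_apply]
  ring

lemma RectBounded.pow {T : ℝ} {P : X → Y → ℝ} (hP : RectBounded T P) (r : ℕ) :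
    RectBounded (T ^ r) (P ^ r) := by
  induction r with
  | zero =>
    have := rectBounded_rect (X := X) (Y := Y) (f := fun _ => 1) (g := fun _ => 1)
      (by simp) (by simp)
    simp only [pow_zero]
    convert this using 1
    ext; simp only [Pi.one_apply, mul_one]
  | succ r ih => rw [pow_succ, pow_succ]; exact ih.mul hP

/-- On a finite-dimensional space every linear functional is continuous and commutes with the
integral over the coins. -/
lemma RectBounded.integral [Fintype X] [Fintype Y] {Ω : Type} [MeasurableSpace Ω]
    (μ : Measure Ω) [IsProbabilityMeasure μ]
    {T : ℝ} {P : Ω → X → Y → ℝ} (hP : ∀ ω, RectBounded T (P ω))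
    (hi : ∀ x y, Integrable (fun ω => P ω x y) μ) :
    RectBounded T (fun x y => ∫ ω, P ω x y ∂μ) := by
  intro L ε hL
  have hInt : Integrable P μ := Integrable.of_eval fun x => Integrable.of_eval fun y => hi x y
  have e : (fun x y => ∫ ω, P ω x y ∂μ) = ∫ ω, P ω ∂μ := by
    ext x y
    rw [eval_integral (fun x => Integrable.of_eval fun y => hi x y),
      eval_integral (fun y => hi x y)]
  rw [e]
  have h := (LinearMap.toContinuousLinearMap L).integral_comp_comm hInt
  simp only [LinearMap.coe_toContinuousLinearMap'] at h
  rw [← h]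
  calc ∫ ω, L (P ω) ∂μ ≤ ∫ _ω, T * ε ∂μ := by
        refine integral_mono ?_ (integrable_const _) fun ω => hP ω L ε hL
        exact (LinearMap.toContinuousLinearMap L).integrable_comp hInt
    _ = T * ε := by simp

/-- The input of every player is known to one of two parties. -/
def IsTwoParty {n : ℕ} {V : Type} (v : X → Y → Fin n → V) : Prop :=
  ∀ i, (∃ F : X → V, ∀ x y, v x y i = F x) ∨ (∃ G : Y → V, ∀ x y, v x y i = G y)

lemma IsTwoParty.exists_indicator {n : ℕ} {V : Type} {v : X → Y → Fin n → V}
    (hv : IsTwoParty v) (i : Fin n) (p : V → Prop) :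
    ∃ (f : X → ℝ) (g : Y → ℝ), (∀ x, f x ∈ Set.Icc 0 1) ∧ (∀ y, g y ∈ Set.Icc 0 1) ∧
      ∀ x y, ind (p (v x y i)) = f x * g y := by
  rcases hv i with ⟨F, hF⟩ | ⟨G, hG⟩
  · refine ⟨fun x => ind (p (F x)), fun _ => 1, ?_, ?_, fun x y => ?_⟩
    · exact fun _ => ind_mem_Icc _
    · simp
    · simp [hF]
  · refine ⟨fun _ => 1, fun y => ind (p (G y)), ?_, ?_, fun x y => ?_⟩
    · simp
    · exact fun _ => ind_mem_Icc _
    · simp [hG]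

/-- The weights `f` and `g` describe the rectangle of inputs that reach the current node. Only those
inputs need to obey the remaining budget `b`, which is what the induction requires: each bit splits
the rectangle in two. -/
lemma Protocol.rectBounded_mul {n : ℕ} {V O : Type} {v : X → Y → Fin n → V}
    (hv : IsTwoParty v) (o : O) (π : Protocol n V O) : ∀ (b : ℕ) (f : X → ℝ) (g : Y → ℝ),
      (∀ x, f x ∈ Set.Icc 0 1) → (∀ y, g y ∈ Set.Icc 0 1) →
      (∀ x y, f x * g y ≠ 0 → π.bits (v x y) ≤ b) →
      RectBounded (2 ^ b) (fun x y => f x * g y * ind (π.output (v x y) = o)) := by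
  induction π with
  | declare i result =>
    intro b f g hf hg _
    obtain ⟨f', g', hf', hg', h⟩ := hv.exists_indicator i (fun w => result w = o)
    have := rectBounded_rect (f := fun x => f x * f' x) (g := fun y => g y * g' y)
      (fun x => ⟨mul_nonneg (hf x).1 (hf' x).1, mul_le_one₀ (hf x).2 (hf' x).1 (hf' x).2⟩)
      (fun y => ⟨mul_nonneg (hg y).1 (hg' y).1, mul_le_one₀ (hg y).2 (hg' y).1 (hg' y).2⟩)
    refine RectBounded.mono ?_ (one_le_pow₀ (by norm_num : (1 : ℝ) ≤ 2) (n := b))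
    convert this using 3 with x y
    rw [Protocol.output, h x y]; ring
  | send i bit next ih =>
    intro b f g hf hg hb
    -- With no budget left, no input of nonzero weight reaches a node that sends a bit.
    cases b with
    | zero =>
      have e : (fun x y => f x * g y *
          ind ((Protocol.send i bit next).output (v x y) = o)) = 0 := by
        ext x y
        by_cases hz : f x * g y = 0
        · simp [hz]
        · simpa [Protocol.bits] using hb x y hz
      rw [e]
      exact rectBounded_zero.mono (by norm_num)
    | succ b =>
      have hβ : ∀ β, RectBounded (2 ^ b) (fun x y => (f x * g y *
          ind (bit (v x y i) = β)) *
            ind ((next β).output (v x y) = o)) := by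
        intro β
        obtain ⟨f', g', hf', hg', h⟩ := hv.exists_indicator i (fun w => bit w = β)
        have := ih β b (fun x => f x * f' x) (fun y => g y * g' y)
          (fun x => ⟨mul_nonneg (hf x).1 (hf' x).1, mul_le_one₀ (hf x).2 (hf' x).1 (hf' x).2⟩)
          (fun y => ⟨mul_nonneg (hg y).1 (hg' y).1, mul_le_one₀ (hg y).2 (hg' y).1 (hg' y).2⟩)
          ?_
        · convert this using 4 with x y
          rw [h x y]; ring
        · intro x y hne
          have e : f x * f' x * (g y * g' y) = f x * g y * (f' x * g' y) := by ring
          rw [e, ← h x y] at hne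
          have h1 := hb x y (left_ne_zero_of_mul hne)
          have h2 : bit (v x y i) = β := by
            by_contra hcon
            exact right_ne_zero_of_mul hne (ind_of_false hcon)
          simp only [Protocol.bits, h2] at h1
          omega
      have := (hβ true).add (hβ false)
      have e2 : (2 : ℝ) ^ b + 2 ^ b = 2 ^ (b + 1) := by ring
      rw [e2] at this
      convert this using 1
      ext x y
      simp only [Protocol.output, Pi.add_apply]
      cases bit (v x y i) <;> simp [ind]

lemma RandomizedProtocol.rectBounded [Fintype X] [Fintype Y] {n : ℕ} {V O : Type}
    {v : X → Y → Fin n → V}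
    (hv : IsTwoParty v) (Γ : RandomizedProtocol n V O)
    {b : ℕ} (hb : Γ.CostAtMost b) (o : O) :
    RectBounded (2 ^ b)
      (fun x y => (coinMeasure n).real {ω | (Γ.det ω).output (v x y) = o}) := by
  classical
  have hm := fun x y => Γ.measurable_output (v x y) o
  have h := RectBounded.integral (coinMeasure n) (T := 2 ^ b)
    (P := fun ω x y => ind ((Γ.det ω).output (v x y) = o)) ?_ ?_
  · convert h using 3 with x y
    rw [← integral_indicator_one (hm x y)]
    rfl
  · intro ω
    have := Protocol.rectBounded_mul hv o (Γ.det ω) b (fun _ => 1) (fun _ => 1) (by simp) (by simp)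
      (fun x y _ => hb ω (v x y))
    simpa using this
  · intro x y
    exact (integrable_const (1 : ℝ)).indicator (hm x y)

end Rectangles

/-! ### Linear lower bound for set disjointness. -/

/-- A bounded-error protocol that decides set disjointness on `ι` has linear cost. -/
theorem disjointness_bound {ι : Type} [Fintype ι] [DecidableEq ι] [Nonempty ι] {n b : ℕ}
    {V : Type} {v : (ι → Bool) → (ι → Bool) → Fin n → V} (hv : IsTwoParty v)
    (Γ : RandomizedProtocol n V Bool) (hb : Γ.CostAtMost b)
    (hΓ : Γ.IsCorrect fun w o => ∀ x y, w = v x y → (o = true ↔ ∃ i, x i = true ∧ y i = true)) :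
    1 / 243 ≤ 5 / 4 * (2 ^ b) ^ 5 * biasRate ^ ((Fintype.card ι : ℝ) / 20) := by
  set N := Fintype.card ι with hN
  have hN0 : 0 < (N : ℝ) := by exact_mod_cast Fintype.card_pos
  set P : (ι → Bool) → (ι → Bool) → ℝ :=
    fun x y => (coinMeasure n).real {ω | (Γ.det ω).output (v x y) = false} with hP
  have hP0 : ∀ x y, 0 ≤ P x y := fun x y => measureReal_nonneg
  have hdisj : ∀ x y, (¬ ∃ i, x i = true ∧ y i = true) → 2 / 3 ≤ P x y := by
    intro x y hxy
    refine (hΓ (v x y)).trans (measureReal_mono fun ω hω => ?_)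
    have := hω x y rfl
    simpa [hxy] using this
  have hInt : ∀ x y, (∃ i, x i = true ∧ y i = true) → P x y ≤ 1 / 3 := by
    intro x y hxy
    have hm := Γ.measurable_output (v x y) false
    have h1 := (hΓ (v x y)).trans (measureReal_mono
      (s₂ := {ω | (Γ.det ω).output (v x y) = false}ᶜ) fun ω hω => ?_)
    · rw [probReal_compl_eq_one_sub hm] at h1
      simp only [hP]; linarith
    · have := hω x y rfl
      simp only [hxy, iff_true] at this
      simp [this]
  -- Five is the least power for which the ratio `2 ^ r` of the two acceptance bounds exceeds 16.
  have hR := (Γ.rectBounded hv hb false).pow 5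
    ((N / 16 : ℝ) • disjointMass - intersectingMass) _ (fun f g hf hg => corruption_bound
      (fun x => (hf x).1) (fun x => (hf x).2) (fun y => (hg y).1) (fun y => (hg y).2))
  rw [← hN] at hR
  have h0 : (8 : ℝ) ^ N * (2 / 3) ^ 5 ≤ disjointMass (P ^ 5) := by
    have hc : ∑ _d : ι → Bool, ∑ _x : ι → Bool, ∑ _y : ι → Bool, ((2 : ℝ) / 3) ^ 5
        = 8 ^ N * (2 / 3) ^ 5 := by
      have e8 : (8 : ℝ) ^ N = 2 ^ N * (2 ^ N * 2 ^ N) := by rw [← mul_pow, ← mul_pow]; norm_num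
      rw [e8]; simp [← hN]; ring
    rw [← hc]
    refine Finset.sum_le_sum fun d _ => Finset.sum_le_sum fun x _ => Finset.sum_le_sum fun y _ => ?_
    refine pow_le_pow_left₀ (by norm_num) (hdisj _ _ ?_) 5
    rintro ⟨i, h1, h2⟩
    simp only [mask, compl, Bool.and_eq_true, Bool.not_eq_true'] at h1 h2
    simp [h1.1] at h2
  have h1 : intersectingMass (P ^ 5) ≤ N * 8 ^ N * (1 / 3) ^ 5 := by
    have hc : ∑ _i : ι, ∑ _d : ι → Bool, ∑ _x : ι → Bool, ∑ _y : ι → Bool, ((1 : ℝ) / 3) ^ 5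
        = (N : ℝ) * 8 ^ N * (1 / 3) ^ 5 := by
      have e8 : (8 : ℝ) ^ N = 2 ^ N * (2 ^ N * 2 ^ N) := by rw [← mul_pow, ← mul_pow]; norm_num
      rw [e8]; simp [← hN]; ring
    rw [← hc]
    refine Finset.sum_le_sum fun i _ => Finset.sum_le_sum fun d _ => Finset.sum_le_sum fun x _ =>
      Finset.sum_le_sum fun y _ => ?_
    exact pow_le_pow_left₀ (hP0 _ _) (hInt _ _ ⟨i, by simp⟩) 5
  have h2 : (N : ℝ) / 16 * disjointMass (P ^ 5) - intersectingMass (P ^ 5)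
      ≤ (2 ^ b) ^ 5 * (5 / 4 * (N * 8 ^ N * biasRate ^ ((N : ℝ) / 20))) := hR
  have h3 := mul_le_mul_of_nonneg_left h0 (by positivity : 0 ≤ (N : ℝ) / 16)
  have h8 : 0 < (N : ℝ) * 8 ^ N := by positivity
  -- Per unit of `N * 8 ^ N`, the left side is at least `(2/3)^5 / 16 - (1/3)^5 = 1/243`.
  refine le_of_mul_le_mul_left ?_ h8
  norm_num at h1 h3
  linarith


/-! ### Submodular set functions with a freely chosen middle level. -/

section Level

variable {α : Type}

/-- The value of a set that depends on its size only, except at size `k`. -/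
noncomputable def levelValue (k : ℕ) (good : Finset α → Bool) (T : Finset α) : ℝ :=
  if T.card < k then T.card else if T.card = k ∧ good T = false then k - 1 / 2 else k

lemma levelValue_le (k : ℕ) (good : Finset α → Bool) (T : Finset α) :
    levelValue k good T ≤ k := by
  unfold levelValue
  split_ifs with h1 h2
  · exact_mod_cast h1.le
  · linarith
  · exact le_rfl

lemma levelValue_nonneg {k : ℕ} (hk : 0 < k) (good : Finset α → Bool) (T : Finset α) :
    0 ≤ levelValue k good T := by
  unfold levelValue
  split_ifs with h1 h2
  · positivity
  · have : (1 : ℝ) ≤ k := by exact_mod_cast hk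
    linarith
  · positivity

lemma levelValue_of_lt {k : ℕ} (good : Finset α → Bool) {T : Finset α} (h : T.card < k) :
    levelValue k good T = T.card := if_pos h

lemma levelValue_of_gt {k : ℕ} (good : Finset α → Bool) {T : Finset α} (h : k < T.card) :
    levelValue k good T = k := by
  unfold levelValue
  rw [if_neg (by omega), if_neg (by omega)]

lemma levelValue_of_eq {k : ℕ} (good : Finset α → Bool) {T : Finset α} (h : T.card = k) :
    k - 1 / 2 ≤ levelValue k good T ∧ levelValue k good T ≤ k := by
  refine ⟨?_, levelValue_le _ _ _⟩
  unfold levelValue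
  rw [if_neg (by omega)]
  split_ifs <;> linarith

lemma le_levelValue_iff {k : ℕ} (good : Finset α → Bool) (T : Finset α) :
    (k : ℝ) ≤ levelValue k good T ↔ k < T.card ∨ (T.card = k ∧ good T = true) := by
  rcases lt_trichotomy T.card k with h | h | h
  · rw [levelValue_of_lt good h, Nat.cast_le]; omega
  · unfold levelValue
    rw [if_neg (by omega)]
    cases hg : good T <;> simp [h]
  · rw [levelValue_of_gt good h]; simp [h]

variable [DecidableEq α]

lemma levelValue_le_insert (k : ℕ) (good : Finset α → Bool) {T : Finset α} {g : α}
    (hg : g ∉ T) : levelValue k good T ≤ levelValue k good (insert g T) := by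
  have hc := Finset.card_insert_of_notMem hg
  rcases lt_or_ge k (T.card + 1) with h | h
  · rw [levelValue_of_gt good (T := insert g T) (by omega)]; exact levelValue_le _ _ _
  rw [levelValue_of_lt good (by omega)]
  rcases eq_or_lt_of_le h with h' | h'
  · have := (levelValue_of_eq good (hc.trans h')).1
    rw [← h'] at this ⊢; push_cast at this; linarith
  · rw [levelValue_of_lt good (by omega), hc]; push_cast; linarith

/-- Marginals are 1 below the middle, at least `1/2` on entering size `k`, at most `1/2` on leaving
it, and 0 beyond. So they decrease with size for any choice of `good`. -/
lemma levelValue_insert_sub_le (k : ℕ) (good : Finset α → Bool) {S T : Finset α} {g : α}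
    (hST : S ⊆ T) (hg : g ∉ T) :
    levelValue k good (insert g T) - levelValue k good T
      ≤ levelValue k good (insert g S) - levelValue k good S := by
  rcases eq_or_ne S T with rfl | hne
  · exact le_rfl
  have hlt := Finset.card_lt_card (hST.ssubset_of_ne hne)
  have hgS : g ∉ S := fun h => hg (hST h)
  have hcS := Finset.card_insert_of_notMem hgS
  have hcT := Finset.card_insert_of_notMem hg
  rcases lt_or_ge k T.card with h | h
  · rw [levelValue_of_gt good h, levelValue_of_gt good (by omega)]
    linarith [levelValue_le_insert k good hgS]
  rcases lt_or_ge (S.card + 1) k with h1 | h1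
  · rw [levelValue_of_lt good (T := insert g S) (by omega),
      levelValue_of_lt good (T := S) (by omega),
      hcS]
    rcases lt_or_ge T.card k with h2 | h2
    · rw [levelValue_of_lt good h2]
      have : levelValue k good (insert g T) ≤ T.card + 1 := by
        rcases lt_or_ge (T.card + 1) k with h3 | h3
        · rw [levelValue_of_lt good (by omega), hcT]; push_cast; exact le_rfl
        · refine (levelValue_le _ _ _).trans ?_
          exact_mod_cast h3
      push_cast; linarith
    · have := (levelValue_of_eq good (le_antisymm h h2)).1
      have := levelValue_le k good (insert g T)
      push_cast; linarith
  · have hT : T.card = k := by omega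
    have hS : S.card + 1 = k := by omega
    have h2 := (levelValue_of_eq good hT).1
    have h3 := (levelValue_of_eq good (hcS.trans hS)).1
    have h4 := levelValue_le k good (insert g T)
    rw [levelValue_of_lt good (T := S) (by omega)]
    rw [← hS] at *
    push_cast at *
    linarith

lemma levelValue_monotone (k : ℕ) (good : Finset α → Bool) : Monotone (levelValue k good) :=
  Finset.monotone_iff_forall_le_insert.2 fun _ _ hg => levelValue_le_insert k good hg

end Level

/-! ### The two kinds of valuations. -/

section Construction

variable {m : ℕ}

/-- Items outside `M` add `w` each to the value of the items in `M`. -/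
noncomputable def levelValuation (k : ℕ) (M : Finset (Fin m)) (w : ℝ)
    (good : Finset (Fin m) → Bool) (hk : 0 < k) (hM : k < M.card) (hw : 0 ≤ w) : Valuation m where
  val S := levelValue k good (S ∩ M) + w * (S \ M).card
  nonneg S := add_nonneg (levelValue_nonneg hk _ _) (by positivity)
  empty := by simp [levelValue, hk]
  mono S T h := add_le_add
    (levelValue_monotone k good (Finset.inter_subset_inter_right h))
    (mul_le_mul_of_nonneg_left
      (Nat.cast_le.2 (Finset.card_le_card (Finset.sdiff_subset_sdiff h subset_rfl))) hw)
  pos := by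
    rw [Finset.univ_inter, levelValue_of_gt good hM]
    positivity

lemma levelValuation_isSubmodular (k : ℕ) (M : Finset (Fin m)) (w : ℝ)
    (good : Finset (Fin m) → Bool) (hk : 0 < k) (hM : k < M.card) (hw : 0 ≤ w) :
    (levelValuation k M w good hk hM hw).IsSubmodular := by
  intro S T g hST
  by_cases hgT : g ∈ T
  · rw [Finset.insert_eq_of_mem hgT, sub_self, sub_nonneg]
    exact Valuation.mono _ _ _ (Finset.subset_insert g S)
  have hgS : g ∉ S := fun h => hgT (hST h)
  simp only [levelValuation]
  by_cases hgM : g ∈ M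
  · rw [Finset.insert_inter_of_mem hgM, Finset.insert_inter_of_mem hgM,
      Finset.insert_sdiff_of_mem _ hgM, Finset.insert_sdiff_of_mem _ hgM]
    have := levelValue_insert_sub_le k good (Finset.inter_subset_inter_right (u := M) hST)
      (g := g) (by simp [hgT])
    linarith
  · rw [Finset.insert_inter_of_notMem hgM, Finset.insert_inter_of_notMem hgM,
      Finset.insert_sdiff_of_notMem _ hgM, Finset.insert_sdiff_of_notMem _ hgM,
      Finset.card_insert_of_notMem (by simp [hgT]), Finset.card_insert_of_notMem (by simp [hgS])]
    push_cast
    linarith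

/-- The valuation of a player who wants only the item `g`. -/
noncomputable def wantsItem (g : Fin m) : Valuation m where
  val S := if g ∈ S then 1 else 0
  nonneg S := by split_ifs <;> norm_num
  empty := by simp
  mono S T h := by
    split_ifs with h1 h2
    · exact le_rfl
    · exact absurd (h h1) h2
    · norm_num
    · exact le_rfl
  pos := by simp

lemma wantsItem_isSubmodular (g : Fin m) : (wantsItem g).IsSubmodular := by
  intro S T a hST
  have h := @hST g
  simp only [wantsItem, Finset.mem_insert]
  by_cases h1 : g = a <;> by_cases h2 : g ∈ S <;> by_cases h3 : g ∈ T <;> simp_all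

end Construction

/-! ### Reduction from disjointness to the existence of a `c`-EF allocation. -/

section Reduction

lemma Allocation.mem_bundle {n m : ℕ} (A : Allocation n m) (i : Fin n) (g : Fin m) :
    g ∈ A.bundle i ↔ A g = i := by
  simp [Allocation.bundle]

/-- The items that only the first two players share. -/
def mainItems (n k : ℕ) : Finset (Fin (2 * k + n - 2)) := Finset.univ.filter fun g => g.val < 2 * k

lemma card_mainItems {n k : ℕ} (hn : 2 < n) : (mainItems n k).card = 2 * k := by
  have : mainItems n k = Finset.univ.map (Fin.castLEEmb (by omega : 2 * k ≤ 2 * k + n - 2)) := by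
    ext g
    simp only [mainItems, Finset.mem_filter, Finset.mem_univ, true_and, Finset.mem_map]
    constructor
    · intro h; exact ⟨⟨g, h⟩, rfl⟩
    · rintro ⟨a, rfl⟩; exact a.2
  rw [this]; simp

/-- The item that player `i ≥ 2` wants. -/
def ownItem {n : ℕ} (k : ℕ) (hn : 2 < n) (i : Fin n) : Fin (2 * k + n - 2) :=
  ⟨2 * k + (i - 2), by omega⟩

/-- The sets of main items that form half of them. -/
abbrev HalfSet (n k : ℕ) : Type := {S // S ∈ (mainItems n k).powersetCard k}

lemma card_halfSet {n k : ℕ} (hn : 2 < n) : Fintype.card (HalfSet n k) = (2 * k).choose k := by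
  rw [Fintype.card_coe, Finset.card_powersetCard, card_mainItems hn]

/-- The extension by `false` of a set of half sets. -/
def extendHalf {n k : ℕ} (x : HalfSet n k → Bool) (T : Finset (Fin (2 * k + n - 2))) : Bool :=
  if h : T ∈ (mainItems n k).powersetCard k then x ⟨T, h⟩ else false

lemma extendHalf_coe {n k : ℕ} (x : HalfSet n k → Bool) (S : HalfSet n k) :
    extendHalf x S.1 = x S := dif_pos S.2

variable {n k : ℕ} {c : ℝ}

/-- The input of a player with the level valuation given by `good`. -/
noncomputable def levelInput (hn : 2 < n) (hk : 0 < k) (hc : 0 < c)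
    (good : Finset (Fin (2 * k + n - 2)) → Bool) : SubmodularValuation (2 * k + n - 2) :=
  ⟨levelValuation k (mainItems n k) (k / c) good hk (by rw [card_mainItems hn]; omega)
    (by positivity), levelValuation_isSubmodular _ _ _ _ _ _ _⟩

/-- The input of a player who wants only the item `g`. -/
noncomputable def wantsInput {m : ℕ} (g : Fin m) : SubmodularValuation m :=
  ⟨wantsItem g, wantsItem_isSubmodular g⟩

lemma wantsInput_val {m : ℕ} (g : Fin m) (S : Finset (Fin m)) :
    (wantsInput g).1.val S = if g ∈ S then 1 else 0 := rfl

/-- The profile in which the good bundles of the first two players are given by `x` and, after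
complementation, by `y`. -/
noncomputable def profile (hn : 2 < n) (hk : 0 < k) (hc : 0 < c) (x y : HalfSet n k → Bool)
    (i : Fin n) : SubmodularValuation (2 * k + n - 2) :=
  if i.val = 0 then levelInput hn hk hc (extendHalf x)
  else if i.val = 1 then levelInput hn hk hc fun T => extendHalf y (mainItems n k \ T)
  else wantsInput (ownItem k hn i)

lemma profile_of_eq_zero (hn : 2 < n) (hk : 0 < k) (hc : 0 < c) (x y : HalfSet n k → Bool)
    {i : Fin n} (hi : i.val = 0) : profile hn hk hc x y i = levelInput hn hk hc (extendHalf x) :=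
  if_pos hi

lemma profile_of_eq_one (hn : 2 < n) (hk : 0 < k) (hc : 0 < c) (x y : HalfSet n k → Bool)
    {i : Fin n} (hi : i.val = 1) : profile hn hk hc x y i
      = levelInput hn hk hc fun T => extendHalf y (mainItems n k \ T) := by
  unfold profile; rw [if_neg (by omega), if_pos hi]

lemma profile_of_two_le (hn : 2 < n) (hk : 0 < k) (hc : 0 < c) (x y : HalfSet n k → Bool)
    {i : Fin n} (hi : 2 ≤ i.val) :
    profile hn hk hc x y i = wantsInput (ownItem k hn i) := by
  unfold profile; rw [if_neg (by omega), if_neg (by omega)]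

lemma profile_isTwoParty (hn : 2 < n) (hk : 0 < k) (hc : 0 < c) :
    IsTwoParty (profile (n := n) hn hk hc) := by
  intro i
  by_cases h0 : i.val = 0
  · exact Or.inl ⟨_, fun x y => profile_of_eq_zero hn hk hc x y h0⟩
  by_cases h1 : i.val = 1
  · exact Or.inr ⟨_, fun x y => profile_of_eq_one hn hk hc x y h1⟩
  · exact Or.inl ⟨fun _ => _, fun x y => profile_of_two_le hn hk hc x y (by omega)⟩

lemma levelInput_val (hn : 2 < n) (hk : 0 < k) (hc : 0 < c)
    (good : Finset (Fin (2 * k + n - 2)) → Bool) (S : Finset (Fin (2 * k + n - 2))) :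
    (levelInput hn hk hc good).1.val S
      = levelValue k good (S ∩ mainItems n k) + k / c * (S \ mainItems n k).card := rfl

lemma ownItem_mem_of_isEF (hn : 2 < n) (hk : 0 < k) (hc : 0 < c) {x y : HalfSet n k → Bool}
    {A : Allocation n (2 * k + n - 2)} (hA : IsEF c (profile hn hk hc x y) A) {i : Fin n}
    (hi : 2 ≤ i.val) : A (ownItem k hn i) = i := by
  by_contra hne
  have h := hA i (A (ownItem k hn i))
  rw [profile_of_two_le hn hk hc x y hi, wantsInput_val, wantsInput_val,
    if_pos ((A.mem_bundle _ _).2 rfl), if_neg (mt (A.mem_bundle _ _).1 hne)] at h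
  linarith

lemma exists_ownItem (hn : 2 < n) {g : Fin (2 * k + n - 2)} (hg : g ∉ mainItems n k) :
    ∃ i : Fin n, 2 ≤ i.val ∧ ownItem k hn i = g := by
  simp only [mainItems, Finset.mem_filter, Finset.mem_univ, true_and, not_lt] at hg
  refine ⟨⟨g - 2 * k + 2, by omega⟩, by simp, Fin.ext ?_⟩
  simp only [ownItem]; omega

lemma ownItem_notMem (hn : 2 < n) (i : Fin n) : ownItem k hn i ∉ mainItems n k := by
  simp [mainItems, ownItem]

lemma bundle_subset_of_isEF (hn : 2 < n) (hk : 0 < k) (hc : 0 < c) {x y : HalfSet n k → Bool}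
    {A : Allocation n (2 * k + n - 2)} (hA : IsEF c (profile hn hk hc x y) A) {i : Fin n}
    (hi : i.val < 2) : A.bundle i ⊆ mainItems n k := by
  intro g hg
  by_contra hgM
  obtain ⟨j, hj, rfl⟩ := exists_ownItem hn hgM
  have h := ownItem_mem_of_isEF hn hk hc hA hj
  rw [Allocation.mem_bundle, h] at hg
  subst hg; omega

/-- The bundle of the third player contains her own item, which is worth `k / c` to the first two;
not envying her forces value `k`. This is where `n > 2` enters the construction. -/
lemma le_levelValue_of_isEF (hn : 2 < n) (hk : 0 < k) (hc : 0 < c) {x y : HalfSet n k → Bool}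
    {A : Allocation n (2 * k + n - 2)} (hA : IsEF c (profile hn hk hc x y) A) {i : Fin n}
    (hi : i.val < 2) {good : Finset (Fin (2 * k + n - 2)) → Bool}
    (hv : profile hn hk hc x y i = levelInput hn hk hc good) :
    (k : ℝ) ≤ levelValue k good (A.bundle i) := by
  have hsub := bundle_subset_of_isEF hn hk hc hA hi
  have h := hA i ⟨2, hn⟩
  rw [hv, levelInput_val, levelInput_val, Finset.inter_eq_left.2 hsub,
    Finset.sdiff_eq_empty_iff_subset.2 hsub, Finset.card_empty, Nat.cast_zero, mul_zero,
    add_zero] at h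
  refine le_trans ?_ h
  have hmem : ownItem k hn ⟨2, hn⟩ ∈ A.bundle ⟨2, hn⟩ \ mainItems n k := by
    simp only [Finset.mem_sdiff, ownItem_notMem, not_false_eq_true, and_true, Allocation.mem_bundle]
    exact ownItem_mem_of_isEF hn hk hc hA le_rfl
  have hcard : (1 : ℝ) ≤ (A.bundle ⟨2, hn⟩ \ mainItems n k).card := by
    exact_mod_cast Finset.card_pos.2 ⟨_, hmem⟩
  have h0 := levelValue_nonneg hk good (A.bundle ⟨2, hn⟩ ∩ mainItems n k)
  calc (k : ℝ) = c * (0 + k / c * 1) := by field_simp; ring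
    _ ≤ _ := by gcongr

/-- Every bundle of `splitAllocation` has one of these two shapes, so value `k` is also enough for
the first two players. -/
lemma levelInput_le (hn : 2 < n) (hk : 0 < k) (hc : 0 < c) (hc1 : c ≤ 1)
    (good : Finset (Fin (2 * k + n - 2)) → Bool) {S : Finset (Fin (2 * k + n - 2))}
    (hS : S ⊆ mainItems n k ∨ ∃ g, S ⊆ {g}) :
    c * (levelInput hn hk hc good).1.val S ≤ k := by
  rw [levelInput_val]
  have hck : c * (k / c) = k := by field_simp
  rcases hS with hS | ⟨g, hS⟩
  · rw [Finset.sdiff_eq_empty_iff_subset.2 hS, Finset.card_empty, Nat.cast_zero, mul_zero, add_zero]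
    calc c * levelValue k good (S ∩ mainItems n k) ≤ 1 * k :=
          mul_le_mul hc1 (levelValue_le _ _ _) (levelValue_nonneg hk _ _) zero_le_one
      _ = k := one_mul _
  · by_cases hg : g ∈ mainItems n k
    · have hS' : S ⊆ mainItems n k := hS.trans (Finset.singleton_subset_iff.2 hg)
      rw [Finset.sdiff_eq_empty_iff_subset.2 hS', Finset.card_empty, Nat.cast_zero, mul_zero,
        add_zero]
      calc c * levelValue k good (S ∩ mainItems n k) ≤ 1 * k :=
            mul_le_mul hc1 (levelValue_le _ _ _) (levelValue_nonneg hk _ _) zero_le_one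
        _ = k := one_mul _
    · have h1 : S ∩ mainItems n k = ∅ := by
        rw [← Finset.disjoint_iff_inter_eq_empty]
        exact Finset.disjoint_of_subset_left hS (Finset.disjoint_singleton_left.2 hg)
      have h2 : ((S \ mainItems n k).card : ℝ) ≤ 1 := by
        exact_mod_cast (Finset.card_le_card (Finset.sdiff_subset.trans hS)).trans_eq
          (Finset.card_singleton g)
      rw [h1, levelValue_of_lt good (by simpa using hk), Finset.card_empty, Nat.cast_zero, zero_add,
        ← mul_assoc, hck]
      exact mul_le_of_le_one_right (by positivity) h2

/-- The allocation that gives `S` and its complement in the main items to the first two players,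
and to every other player her own item. -/
def splitAllocation (hn : 2 < n) (S : Finset (Fin (2 * k + n - 2))) :
    Allocation n (2 * k + n - 2) := fun g =>
  if g ∈ S then ⟨0, by omega⟩ else if g.val < 2 * k then ⟨1, by omega⟩
  else ⟨g.val - 2 * k + 2, by omega⟩

lemma splitAllocation_isEF (hn : 2 < n) (hk : 0 < k) (hc : 0 < c) (hc1 : c ≤ 1)
    {x y : HalfSet n k → Bool} (S : HalfSet n k) (hx : x S = true) (hy : y S = true) :
    IsEF c (profile hn hk hc x y) (splitAllocation hn S.1) := by
  obtain ⟨hSM, hcard⟩ := Finset.mem_powersetCard.1 S.2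
  have hM : ∀ g, g ∈ mainItems n k ↔ g.val < 2 * k := by simp [mainItems]
  have hlt : ∀ g ∈ S.1, g.val < 2 * k := fun g hg => (hM g).1 (hSM hg)
  have hb0 : ∀ i : Fin n, i.val = 0 → (splitAllocation hn S.1).bundle i = S.1 := by
    intro i hi
    ext g
    rw [Allocation.mem_bundle, splitAllocation]
    split_ifs with h1 h2 <;> simp [h1, Fin.ext_iff, hi]
  have hb1 : ∀ i : Fin n, i.val = 1 →
      (splitAllocation hn S.1).bundle i = mainItems n k \ S.1 := by
    intro i hi
    ext g
    rw [Allocation.mem_bundle, splitAllocation, Finset.mem_sdiff, hM]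
    split_ifs with h1 h2 <;> simp [h1, Fin.ext_iff, hi] <;> omega
  have hb : ∀ i : Fin n, 2 ≤ i.val →
      (splitAllocation hn S.1).bundle i = {ownItem k hn i} := by
    intro i hi
    ext g
    have := hlt g
    rw [Allocation.mem_bundle, splitAllocation, Finset.mem_singleton]
    split_ifs with h1 h2 <;> simp only [Fin.ext_iff, ownItem]
    · have := this h1; omega
    · omega
    · omega
  have hcover : ∀ j, (splitAllocation hn S.1).bundle j ⊆ mainItems n k ∨
      ∃ g, (splitAllocation hn S.1).bundle j ⊆ {g} := by
    intro j
    by_cases h2 : 2 ≤ j.val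
    · exact Or.inr ⟨_, (hb j h2).le⟩
    left
    by_cases h0 : j.val = 0
    · rw [hb0 j h0]; exact hSM
    · rw [hb1 j (by omega)]
      exact Finset.sdiff_subset
  intro i j
  by_cases h0 : i.val = 0
  · rw [profile_of_eq_zero hn hk hc x y h0]
    refine (levelInput_le hn hk hc hc1 _ (hcover j)).trans ?_
    rw [hb0 i h0, levelInput_val, Finset.inter_eq_left.2 hSM]
    have h := (le_levelValue_iff (k := k) (extendHalf x) S.1).2
      (Or.inr ⟨hcard, (extendHalf_coe x S).trans hx⟩)
    have : 0 ≤ k / c * ((S.1 \ mainItems n k).card : ℝ) := by positivity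
    linarith
  by_cases h1 : i.val = 1
  · rw [profile_of_eq_one hn hk hc x y h1]
    refine (levelInput_le hn hk hc hc1 _ (hcover j)).trans ?_
    rw [hb1 i h1, levelInput_val, Finset.inter_eq_left.2 Finset.sdiff_subset]
    have h := (le_levelValue_iff (k := k) (fun T => extendHalf y (mainItems n k \ T))
      (mainItems n k \ S.1)).2 (Or.inr ⟨?_, ?_⟩)
    · have : 0 ≤ k / c * (((mainItems n k \ S.1) \ mainItems n k).card : ℝ) := by positivity
      linarith
    · rw [Finset.card_sdiff_of_subset hSM, hcard, card_mainItems hn]; omega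
    · simp only [Finset.sdiff_sdiff_eq_self hSM]
      exact (extendHalf_coe y S).trans hy
  · rw [profile_of_two_le hn hk hc x y (by omega), hb i (by omega), wantsInput_val, wantsInput_val,
      if_pos (Finset.mem_singleton_self _)]
    split_ifs <;> linarith

/-- Allocations that are `c`-EF correspond to common elements of the two sets of half sets. -/
theorem exists_isEF_profile_iff (hn : 2 < n) (hk : 0 < k) (hc : 0 < c) (hc1 : c ≤ 1)
    (x y : HalfSet n k → Bool) :
    (∃ A, IsEF c (profile hn hk hc x y) A) ↔ ∃ S, x S = true ∧ y S = true := by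
  constructor
  · rintro ⟨A, hA⟩
    set B0 := A.bundle ⟨0, by omega⟩ with hB0
    set B1 := A.bundle ⟨1, by omega⟩ with hB1
    have s0 : B0 ⊆ mainItems n k := bundle_subset_of_isEF hn hk hc hA (by simp)
    have s1 : B1 ⊆ mainItems n k := bundle_subset_of_isEF hn hk hc hA (by simp)
    have v0 := (le_levelValue_iff _ _).1 (le_levelValue_of_isEF hn hk hc hA
      (i := ⟨0, by omega⟩) (by simp) (good := extendHalf x) rfl)
    have v1 := (le_levelValue_iff _ _).1 (le_levelValue_of_isEF hn hk hc hA
      (i := ⟨1, by omega⟩) (by simp)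
      (good := fun T => extendHalf y (mainItems n k \ T)) rfl)
    rw [← hB0] at v0
    rw [← hB1] at v1
    have hdis : Disjoint B0 B1 := by
      rw [Finset.disjoint_left]
      intro g h0 h1
      rw [hB0, Allocation.mem_bundle] at h0
      rw [hB1, Allocation.mem_bundle, h0] at h1
      simp at h1
    have hun : (B0 ∪ B1).card = B0.card + B1.card := Finset.card_union_of_disjoint hdis
    have hle : (B0 ∪ B1).card ≤ 2 * k := by
      exact (Finset.card_le_card (Finset.union_subset s0 s1)).trans_eq (card_mainItems hn)
    -- Both bundles have at least `k` items and they are disjoint inside a set of `2 * k`.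
    have c0 : B0.card = k := by omega
    have c1 : B1.card = k := by omega
    have e : mainItems n k \ B1 = B0 := by
      refine (Finset.eq_of_subset_of_card_le ?_ ?_).symm
      · exact Finset.subset_sdiff.2 ⟨s0, hdis⟩
      · rw [Finset.card_sdiff_of_subset s1, card_mainItems hn]; omega
    have g0 : extendHalf x B0 = true := by
      rcases v0 with h | h
      · omega
      · exact h.2
    have g1 : extendHalf y B0 = true := by
      rcases v1 with h | h
      · omega
      · rw [← e]; exact h.2
    let S : HalfSet n k := ⟨B0, Finset.mem_powersetCard.2 ⟨s0, c0⟩⟩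
    exact ⟨S, (extendHalf_coe x S).symm.trans g0, (extendHalf_coe y S).symm.trans g1⟩
  · rintro ⟨S, hx, hy⟩
    exact ⟨_, splitAllocation_isEF hn hk hc hc1 S hx hy⟩

end Reduction

/-! ### Existence of protocols of finite cost, and passage from search to decision. -/

section Upper

variable {n : ℕ} {V O : Type}

/-- The protocol in which all the questions in a list are answered, one bit each. -/
def Protocol.queryAll (i₀ : Fin n) : List (Fin n × (V → Bool)) → (List Bool → O) → Protocol n V O
  | [], out => .declare i₀ fun _ => out []
  | q :: l, out => .send q.1 q.2 fun β => queryAll i₀ l fun a => out (β :: a)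

lemma Protocol.output_queryAll (i₀ : Fin n) (v : Fin n → V) (l : List (Fin n × (V → Bool))) :
    ∀ out : List Bool → O,
      (Protocol.queryAll i₀ l out).output v = out (l.map fun q => q.2 (v q.1)) := by
  induction l with
  | nil => intro out; rfl
  | cons q l ih => intro out; exact ih _

lemma Protocol.bits_queryAll (i₀ : Fin n) (v : Fin n → V) (l : List (Fin n × (V → Bool))) :
    ∀ out : List Bool → O, (Protocol.queryAll i₀ l out).bits v = l.length := by
  induction l with
  | nil => intro out; rfl
  | cons q l ih => intro out; exact congrArg (· + 1) (ih _)

/-- A deterministic protocol as a randomized one. -/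
def RandomizedProtocol.ofDet (π : Protocol n V O) : RandomizedProtocol n V O where
  det _ := π
  measurable_output _ _ := MeasurableSet.const _

lemma RandomizedProtocol.isCorrect_ofDet {π : Protocol n V O} {spec : (Fin n → V) → O → Prop}
    (h : ∀ v, spec v (π.output v)) : (RandomizedProtocol.ofDet π).IsCorrect spec := by
  intro v
  have : {ω : Coins n | spec v (((RandomizedProtocol.ofDet π).det ω).output v)} = Set.univ :=
    Set.eq_univ_of_forall fun _ => h v
  rw [this, probReal_univ]
  norm_num

/-- Finitely many questions that determine the correct results give a protocol. -/
lemma exists_protocol_of_queries [Nonempty O] (i₀ : Fin n) {spec : (Fin n → V) → O → Prop}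
    (l : List (Fin n × (V → Bool))) (hex : ∀ v, ∃ o, spec v o)
    (hl : ∀ v w, (l.map fun q => q.2 (v q.1)) = (l.map fun q => q.2 (w q.1)) →
      ∀ o, spec v o → spec w o) :
    ∃ Γ : RandomizedProtocol n V O, Γ.IsCorrect spec ∧ Γ.CostAtMost l.length := by
  have hout : ∀ a : List Bool, ∃ o : O,
      ∀ v : Fin n → V, (l.map fun q => q.2 (v q.1)) = a → spec v o := by
    intro a
    by_cases ha : ∃ v : Fin n → V, (l.map fun q => q.2 (v q.1)) = a
    · obtain ⟨v, hv⟩ := ha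
      obtain ⟨o, ho⟩ := hex v
      exact ⟨o, fun w hw => hl v w (hv.trans hw.symm) o ho⟩
    · exact ⟨Classical.arbitrary O, fun v hv => absurd ⟨v, hv⟩ ha⟩
  choose out hout using hout
  refine ⟨.ofDet (.queryAll i₀ l out), RandomizedProtocol.isCorrect_ofDet fun v => ?_,
    fun _ v => (Protocol.bits_queryAll i₀ v l out).le⟩
  rw [Protocol.output_queryAll]
  exact hout _ v rfl

/-- A protocol of minimum cost. -/
lemma exists_protocol_cost_eq {spec : (Fin n → V) → O → Prop}
    (h : ∃ (Γ : RandomizedProtocol n V O) (b : ℕ), Γ.IsCorrect spec ∧ Γ.CostAtMost b) :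
    ∃ Γ : RandomizedProtocol n V O, Γ.IsCorrect spec ∧
      Γ.CostAtMost (randomizedComplexity spec) := by
  obtain ⟨Γ, b, hΓ⟩ := h
  exact Nat.sInf_mem (s := {b | ∃ Γ : RandomizedProtocol n V O, Γ.IsCorrect spec ∧ Γ.CostAtMost b})
    ⟨b, Γ, hΓ⟩

/-- Postprocessing of the result. -/
def Protocol.map {O' : Type} (F : O → O') : Protocol n V O → Protocol n V O'
  | .declare i result => .declare i (F ∘ result)
  | .send i bit next => .send i bit fun β => (next β).map F

lemma Protocol.output_map {O' : Type} (F : O → O') (v : Fin n → V) (π : Protocol n V O) :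
    (π.map F).output v = F (π.output v) := by
  induction π with
  | declare i result => rfl
  | send i bit next ih => exact ih _

lemma Protocol.bits_map {O' : Type} (F : O → O') (v : Fin n → V) (π : Protocol n V O) :
    (π.map F).bits v = π.bits v := by
  induction π with
  | declare i result => rfl
  | send i bit next ih => exact congrArg (· + 1) (ih _)

/-- Postprocessing of the result of a randomized protocol. -/
def RandomizedProtocol.map {O' : Type} [Finite O] (F : O → O') (Γ : RandomizedProtocol n V O) :
    RandomizedProtocol n V O' where
  det ω := (Γ.det ω).map F
  measurable_output v o := by
    have : {ω | ((Γ.det ω).map F).output v = o}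
        = ⋃ a ∈ {a | F a = o}, {ω | (Γ.det ω).output v = a} := by
      ext ω; simp [Protocol.output_map]
    rw [this]
    exact MeasurableSet.biUnion (Set.to_countable _) fun a _ => Γ.measurable_output v a

lemma exists_protocol_map {O' : Type} [Finite O] {spec : (Fin n → V) → O → Prop}
    {spec' : (Fin n → V) → O' → Prop} (F : O → O') (hF : ∀ v o, spec v o → spec' v (F o)) {b : ℕ}
    (h : ∃ Γ : RandomizedProtocol n V O, Γ.IsCorrect spec ∧ Γ.CostAtMost b) :
    ∃ Γ : RandomizedProtocol n V O', Γ.IsCorrect spec' ∧ Γ.CostAtMost b := by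
  obtain ⟨Γ, hΓ, hb⟩ := h
  refine ⟨Γ.map F, fun v => (hΓ v).trans (measureReal_mono fun ω hω => ?_), fun ω v => ?_⟩
  · simp only [RandomizedProtocol.map, Protocol.output_map, Set.mem_ofPred_eq]
    exact hF _ _ hω
  · simp only [RandomizedProtocol.map, Protocol.bits_map]
    exact hb ω v

end Upper

/-- Although valuations are real-valued, finitely many bits suffice: each player says of each
allocation whether she accepts it. Hence the infimum that defines the complexity is attained. -/
lemma exists_findEF_protocol (n m : ℕ) (hn : 0 < n) (c : ℝ) :
    ∃ Γ : RandomizedProtocol n (SubmodularValuation m) (Option (Allocation n m)),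
      Γ.IsCorrect (findEF n m c) ∧ Γ.CostAtMost (RsubmodEF n m c) := by
  classical
  refine exists_protocol_cost_eq ?_
  let query : Allocation n m × Fin n → Fin n × (SubmodularValuation m → Bool) := fun p =>
    (p.2, fun v => decide (∀ j, c * v.1.val (p.1.bundle j) ≤ v.1.val (p.1.bundle p.2)))
  refine Exists.imp (fun Γ hΓ => ⟨_, hΓ⟩) (exists_protocol_of_queries ⟨0, hn⟩
    ((Finset.univ : Finset (Allocation n m × Fin n)).toList.map query) ?_ ?_)
  · intro v
    by_cases h : ∃ A : Allocation n m, IsEF c v A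
    · exact ⟨some h.choose, h.choose_spec⟩
    · exact ⟨none, h⟩
  · intro v w hvw o ho
    rw [List.map_map, List.map_map, List.map_inj_left] at hvw
    have e : ∀ A, IsEF c v A ↔ IsEF c w A := by
      intro A
      refine forall_congr' fun i => ?_
      have := hvw (A, i) (by simp)
      simpa [query] using this
    cases o with
    | none => simpa [findEF, e] using ho
    | some A => exact (e A).1 ho

/-- A finding protocol decides existence. -/
lemma decideEF_isSome {n m : ℕ} {c : ℝ} (v : Fin n → SubmodularValuation m)
    (o : Option (Allocation n m)) (h : findEF n m c v o) : decideEF n m c v o.isSome := by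
  cases o with
  | none => simpa [decideEF, findEF] using h
  | some A => simpa [decideEF] using ⟨A, h⟩

/-! ### The cost bound and its asymptotic form. -/

/-- Protocols that decide the existence of a `c`-EF allocation have cost linear in the number of
half sets. -/
lemma decideEF_cost_bound {n k b : ℕ} {c : ℝ} (hn : 2 < n) (hk : 0 < k) (hc0 : 0 < c) (hc1 : c ≤ 1)
    (h : ∃ Γ : RandomizedProtocol n (SubmodularValuation (2 * k + n - 2)) Bool,
      Γ.IsCorrect (decideEF n (2 * k + n - 2) c) ∧ Γ.CostAtMost b) :
    1 / 243 ≤ 5 / 4 * (2 ^ b) ^ 5 * biasRate ^ (((2 * k).choose k : ℝ) / 20) := by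
  obtain ⟨Γ, hΓ, hb⟩ := h
  have : Nonempty (HalfSet n k) := by
    rw [← Fintype.card_pos_iff, card_halfSet hn]
    exact Nat.choose_pos (by omega)
  rw [← card_halfSet hn]
  refine disjointness_bound (profile_isTwoParty hn hk hc0) Γ hb fun v =>
    (hΓ v).trans (measureReal_mono ?_)
  rintro ω hω x y rfl
  rw [← exists_isEF_profile_iff hn hk hc0 hc1]
  exact hω

/-- Taking logarithms gives a linear inequality with additive constant `log (1215 / 4)`, where `1215
/ 4 = 243 * (5 / 4)`. -/
lemma isBigO_of_cost_bound (R : ℕ → ℕ)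
    (hR : ∀ k, 0 < k → 1 / 243 ≤ 5 / 4 * ((2 : ℝ) ^ R k) ^ 5 *
      biasRate ^ (((2 * k).choose k : ℝ) / 20)) :
    (fun k : ℕ => ((2 * k).choose k : ℝ)) =O[atTop] fun k : ℕ => (R k : ℝ) := by
  set γ := -Real.log biasRate / 20 with hγ
  have hγ0 : 0 < γ := by
    have := Real.log_neg biasRate_pos biasRate_lt_one
    rw [hγ]; linarith
  have hlin : ∀ k, 0 < k →
      γ * (2 * k).choose k ≤ R k * (5 * Real.log 2) + Real.log (1215 / 4) := by
    intro k hk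
    have h := Real.log_le_log (by norm_num) (hR k hk)
    have hp := Real.rpow_pos_of_pos biasRate_pos (((2 * k).choose k : ℝ) / 20)
    rw [Real.log_mul (by positivity) hp.ne', Real.log_mul (by norm_num) (by positivity),
      Real.log_rpow biasRate_pos, Real.log_pow, Real.log_pow] at h
    have e : Real.log (1215 / 4) = Real.log (5 / 4) - Real.log (1 / 243) := by
      rw [← Real.log_div (by norm_num) (by norm_num)]; norm_num
    rw [e, hγ]
    push_cast at h
    linarith
  have hgrow : ∀ k : ℕ, (k : ℝ) ≤ (2 * k).choose k := by
    intro k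
    rw [← Nat.centralBinom_eq_two_mul_choose]
    exact_mod_cast Nat.centralBinom_strictMono.le_apply
  -- The factor 2 absorbs the additive constant, which is at most half of `γ * (2 * k).choose k` for
  -- large `k`.
  refine IsBigO.of_bound (2 * (5 * Real.log 2) / γ) ?_
  filter_upwards [eventually_gt_atTop 0, eventually_ge_atTop ⌈2 * Real.log (1215 / 4) / γ⌉₊]
    with k hk hk2
  rw [Real.norm_natCast, Real.norm_natCast]
  have h1 := (Nat.ceil_le.1 hk2).trans (hgrow k)
  rw [div_le_iff₀ hγ0] at h1
  have h2 := hlin k hk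
  rw [div_mul_eq_mul_div, le_div_iff₀ hγ0]
  linarith

end FairDivision

theorem mainTheorem4 (n : ℕ) (hn : 2 < n) (c : ℝ) (hc0 : 0 < c) (hc1 : c ≤ 1) :
    ((fun k : ℕ => ((2 * k).choose k : ℝ)) =O[atTop]
      fun k : ℕ => (FairDivision.RsubmodDecideEF n (2 * k + n - 2) c : ℝ)) ∧
    ((fun k : ℕ => ((2 * k).choose k : ℝ)) =O[atTop]
      fun k : ℕ => (FairDivision.RsubmodEF n (2 * k + n - 2) c : ℝ)) := by
  open FairDivision in
  -- This yields the second bound directly; for the first it only certifies that some decision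
  -- protocol has finite cost.
  have hdec : ∀ m, ∃ Γ : RandomizedProtocol n (SubmodularValuation m) Bool,
      Γ.IsCorrect (decideEF n m c) ∧ Γ.CostAtMost (RsubmodEF n m c) := fun m =>
    exists_protocol_map Option.isSome decideEF_isSome (exists_findEF_protocol n m (by omega) c)
  refine ⟨FairDivision.isBigO_of_cost_bound _ fun k hk => ?_,
    FairDivision.isBigO_of_cost_bound _ fun k hk => ?_⟩
  · obtain ⟨Γ, hΓ⟩ := hdec (2 * k + n - 2)
    exact FairDivision.decideEF_cost_bound hn hk hc0 hc1
      (FairDivision.exists_protocol_cost_eq ⟨Γ, _, hΓ⟩)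
  · exact FairDivision.decideEF_cost_bound hn hk hc0 hc1 (hdec _)
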